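/- There are universal constants $c, C > 0$ such that the following holds for every $\epsilon \in (0,1)$, every dimension $d \ge C/\epsilon$ and every $m \in \mathbb{N}$. Consider a (possibly randomized) algorithm that accesses a positive semidefinite matrix $A \in \mathbb{R}^{d\times d}$ only through the matrix-vector products $A r_1, \ldots, A r_m$, where the query vectors $r_1, \ldots, r_m \in \mathbb{R}^d$ have arbitrary real entries and are chosen non-adaptively: they are (possibly random but) chosen before any product is seen and do not depend on $A$. From its random coins, the queries and the answers $A r_1, \ldots, A r_m$ the algorithm computes an arbitrary (measurable) real-valued estimate $t$. If for every positive semidefinite $A \in \mathbb{R}^{d \times d}$ the estimate satisfies \[(1-\epsilon)\operatorname{tr}(A) \le t \le (1+\epsilon)\operatorname{tr}(A)\] with probability $> \frac34$ over the random coins, then $m \ge c/\epsilon$. In other words, $m = \Omega(1/\epsilon)$ queries are required. -/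

import Mathlib

open MeasureTheory
open scoped Matrix

/-- A randomized non-adaptive matrix-vector query algorithm for `d × d` real matrices that makes
`m` queries; `Ω` is the space of its random coins. The (arbitrary real) query vectors are a
function of the coins alone, so they never depend on the input matrix. The estimate is an
arbitrary measurable function of the coins (and hence of the queries) and of the `m` answers.
A deterministic algorithm is one that ignores the coins. -/
structure NonadaptiveAlgorithm (Ω : Type*) [MeasurableSpace Ω] (d m : ℕ) where
  /-- the query vectors `r₁, …, rₘ` -/
  query : Ω → Fin m → Fin d → ℝ
  measurable_query : Measurable query
  /-- the estimate computed from the coins and the answers `A r₁, …, A rₘ` -/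
  estimate : Ω × (Fin m → Fin d → ℝ) → ℝ
  measurable_estimate : Measurable estimate

namespace NonadaptiveAlgorithm

variable {Ω : Type*} [MeasurableSpace Ω] {d m : ℕ}

/-- The output of the algorithm on the input matrix `A` when the coins are `ω`. -/
def output (alg : NonadaptiveAlgorithm Ω d m) (A : Matrix (Fin d) (Fin d) ℝ) (ω : Ω) : ℝ :=
  alg.estimate (ω, fun i => A *ᵥ alg.query ω i)

/-- On every positive semidefinite input, with probability more than `3/4` over the coins, the
output approximates the trace up to the relative error `ε`. -/
def EstimatesTrace (alg : NonadaptiveAlgorithm Ω d m) (P : Measure Ω) (ε : ℝ) : Prop :=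
  ∀ A : Matrix (Fin d) (Fin d) ℝ, A.PosSemidef →
    3 / 4 < P.real {ω | (1 - ε) * A.trace ≤ alg.output A ω ∧
      alg.output A ω ≤ (1 + ε) * A.trace}

end NonadaptiveAlgorithm

/-! The hard input is the `n × n` matrix `A = 3 √n • 1 + (G + Gᵀ) / 2`, padded with zeros to size
`d × d`, where `n` is of order `1 / ε` and `G` is Gaussian with density `exp (-π ‖G‖²)` for the
Frobenius norm `‖G‖`.

* `A` is positive semidefinite, with trace at most `6 n √n`, with high probability
  (`gaussianPi_exists_lt_abs_inner_selfTensor_le`): the quadratic form of `G` is bounded by `3 √n`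
  on the unit sphere. In place of a net, the proof integrates the exponential of the form over the
  unit ball: a large value at one unit vector forces large values on a set of volume at least a
  fixed multiple of `4⁻ⁿ` times that of the ball (`le_ballMoment`), while the expected integral is
  explicit.
* For fixed coins let `D` be the orthogonal projection onto the complement of the queries. Since
  the queries do not depend on `A`, neither does `D`, and `D` annihilates them, so replacing `G` by
  `G + D / (10 √n)` changes no answer. It raises the trace by `tr D / (10 √n)`, hence by at least
  `√n / 20` if there are at most `n / 2` queries. For `n` a small multiple of `1 / ε` this
  exceeds the error allowed at trace `6 n √n`, so the common estimate is wrong for one of the two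
  inputs. The translation is by a vector of norm at most `1 / 10`, which hardly changes Gaussian
  probabilities (`gaussianPi_le_preimage_add`). So any fixed choice of coins succeeds on not much
  more than half of the inputs (`NonadaptiveAlgorithm.gaussianPi_successSet_le`).

Averaging over coins and inputs contradicts a success probability of `3 / 4` on every positive
semidefinite input, unless `n < 2 m` (`NonadaptiveAlgorithm.EstimatesTrace.lt_two_mul_queries`).
For large `ε` the bound only says that at least one query is made. -/

/-! ### The Gaussian measure with density `exp (-π ‖v‖²)` -/

section Gaussian

variable {V : Type*} [NormedAddCommGroup V] [InnerProductSpace ℝ V] [FiniteDimensional ℝ V]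
  [MeasurableSpace V] [BorelSpace V]

/-- The centred Gaussian measure on a Euclidean space with density `exp (-π ‖v‖²)`. The variance
`1 / (2π)` of each coordinate makes the normalizing constant equal to `1`. -/
noncomputable def gaussianPi (V : Type*) [NormedAddCommGroup V] [InnerProductSpace ℝ V]
    [FiniteDimensional ℝ V] [MeasurableSpace V] [BorelSpace V] : Measure V :=
  volume.withDensity fun v => ENNReal.ofReal (Real.exp (-Real.pi * ‖v‖ ^ 2))

lemma lintegral_exp_neg_pi_norm_sq :
    ∫⁻ v : V, ENNReal.ofReal (Real.exp (-Real.pi * ‖v‖ ^ 2)) = 1 := by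
  have hI : ∫ v : V, Real.exp (-Real.pi * ‖v‖ ^ 2) = 1 := by
    rw [GaussianFourier.integral_rexp_neg_mul_sq_norm Real.pi_pos, div_self Real.pi_ne_zero,
      Real.one_rpow]
  have hint : Integrable fun v : V => Real.exp (-Real.pi * ‖v‖ ^ 2) := by
    by_contra h
    rw [integral_undef h] at hI
    exact zero_ne_one hI
  rw [← ofReal_integral_eq_lintegral_ofReal hint (.of_forall fun v => (Real.exp_pos _).le), hI,
    ENNReal.ofReal_one]

lemma lintegral_exp_neg_pi_norm_sub_sq (h : V) :
    ∫⁻ v : V, ENNReal.ofReal (Real.exp (-Real.pi * ‖v - h‖ ^ 2)) = 1 := by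
  rw [lintegral_sub_right_eq_self (fun v => ENNReal.ofReal (Real.exp (-Real.pi * ‖v‖ ^ 2))) h]
  exact lintegral_exp_neg_pi_norm_sq

instance : IsProbabilityMeasure (gaussianPi V) := by
  constructor
  rw [gaussianPi, withDensity_apply _ MeasurableSet.univ, setLIntegral_univ]
  exact lintegral_exp_neg_pi_norm_sq

/-- The moment generating function of the Gaussian measure, by completing the square. -/
lemma lintegral_exp_inner_gaussianPi (w : V) :
    ∫⁻ v, ENNReal.ofReal (Real.exp (inner ℝ w v)) ∂gaussianPi V =
      ENNReal.ofReal (Real.exp (‖w‖ ^ 2 / (4 * Real.pi))) := by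
  have hpi := Real.pi_pos
  rw [gaussianPi, lintegral_withDensity_eq_lintegral_mul _ (by fun_prop) (by fun_prop)]
  have key : ∀ v : V,
      ((fun v : V => ENNReal.ofReal (Real.exp (-Real.pi * ‖v‖ ^ 2))) *
        fun v => ENNReal.ofReal (Real.exp (inner ℝ w v))) v =
      ENNReal.ofReal (Real.exp (‖w‖ ^ 2 / (4 * Real.pi))) *
        ENNReal.ofReal (Real.exp (-Real.pi * ‖v - (1 / (2 * Real.pi)) • w‖ ^ 2)) := by
    intro v
    rw [Pi.mul_apply, ← ENNReal.ofReal_mul (Real.exp_pos _).le,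
      ← ENNReal.ofReal_mul (Real.exp_pos _).le, ← Real.exp_add, ← Real.exp_add,
      norm_sub_sq_real, inner_smul_right, norm_smul, real_inner_comm, mul_pow,
      Real.norm_eq_abs, sq_abs]
    congr 2
    field_simp
    ring
  simp_rw [key]
  rw [lintegral_const_mul _ (by fun_prop), lintegral_exp_neg_pi_norm_sub_sq, mul_one]

/-- Translating by a vector of norm at most `1 / 10` changes Gaussian probabilities by little.
With `ρ` the likelihood ratio of the translate, this is `|ρ - 1| ≤ 1 / 8 + 2 (ρ - 1)²`
together with the explicit second moment of `ρ`. -/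
lemma gaussianPi_le_preimage_add {E : Set V} (hE : MeasurableSet E) {h : V} (hh : ‖h‖ ≤ 1 / 10) :
    (gaussianPi V).real E ≤ (gaussianPi V).real ((fun v => v + h) ⁻¹' E) + 3 / 10 := by
  have hpi := Real.pi_pos
  set f : V → ℝ := fun v => Real.exp (-Real.pi * ‖v‖ ^ 2) with hf
  set c : ℝ := Real.exp (2 * Real.pi * ‖h‖ ^ 2) with hc
  have hfm : Measurable f := by fun_prop
  have hfp : ∀ v, 0 < f v := fun v => Real.exp_pos _
  have hf1 : ∀ k : V, ∫⁻ v, ENNReal.ofReal (f (v - k)) = 1 := lintegral_exp_neg_pi_norm_sub_sq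
  -- the square of the translated density over the density is again a multiple of a translate
  have hsq : ∀ v, f (v - h) ^ 2 = f v * (c * f (v - (2 : ℝ) • h)) := by
    intro v
    simp only [hf, hc]
    rw [← Real.exp_add, ← Real.exp_add, ← Real.exp_nat_mul, norm_sub_sq_real, norm_sub_sq_real,
      inner_smul_right, norm_smul]
    congr 1
    simp
    ring
  have hpt : ∀ v, E.indicator (fun v => ENNReal.ofReal (f v)) v + 4 * ENNReal.ofReal (f (v - h)) ≤
      E.indicator (fun v => ENNReal.ofReal (f (v - h))) v +
        (ENNReal.ofReal (17 / 8) * ENNReal.ofReal (f v) +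
          ENNReal.ofReal (2 * c) * ENNReal.ofReal (f (v - (2 : ℝ) • h))) := by
    intro v
    have h0 := hfp v
    have h1 := hfp (v - h)
    have h2 := hfp (v - (2 : ℝ) • h)
    have hcp : 0 < c := Real.exp_pos _
    have e4 : (4 : ENNReal) = ENNReal.ofReal 4 := by norm_num
    have hs := hsq v
    have hg : c * f (v - (2 : ℝ) • h) = f (v - h) ^ 2 / f v := by
      rw [hs]; field_simp
    rw [e4, ← ENNReal.ofReal_mul (by norm_num), ← ENNReal.ofReal_mul (by norm_num),
      ← ENNReal.ofReal_mul (by positivity), ← ENNReal.ofReal_add (by positivity) (by positivity)]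
    have main : f v + 4 * f (v - h) ≤
        f (v - h) + (17 / 8 * f v + 2 * c * f (v - (2 : ℝ) • h)) := by
      rw [mul_assoc 2, hg]
      have : f (v - h) + (17 / 8 * f v + 2 * (f (v - h) ^ 2 / f v)) - (f v + 4 * f (v - h)) =
        (2 * (f (v - h) - 3 / 4 * f v) ^ 2) / f v := by field_simp; ring
      have h3 : 0 ≤ (2 * (f (v - h) - 3 / 4 * f v) ^ 2) / f v := by positivity
      linarith
    have main' : 4 * f (v - h) ≤ 17 / 8 * f v + 2 * c * f (v - (2 : ℝ) • h) := by
      rw [mul_assoc 2, hg]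
      have : 17 / 8 * f v + 2 * (f (v - h) ^ 2 / f v) - 4 * f (v - h) =
        (2 * (f (v - h) - f v) ^ 2 + 1 / 8 * f v ^ 2) / f v := by field_simp; ring
      have h3 : 0 ≤ (2 * (f (v - h) - f v) ^ 2 + 1 / 8 * f v ^ 2) / f v := by positivity
      linarith
    by_cases hv : v ∈ E
    · rw [Set.indicator_of_mem hv, Set.indicator_of_mem hv,
        ← ENNReal.ofReal_add (by positivity) (by positivity),
        ← ENNReal.ofReal_add (by positivity) (by positivity)]
      exact ENNReal.ofReal_le_ofReal main
    · rw [Set.indicator_of_notMem hv, Set.indicator_of_notMem hv, zero_add, zero_add]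
      exact ENNReal.ofReal_le_ofReal main'
  have hint := lintegral_mono (μ := (volume : Measure V)) hpt
  have hm1 : Measurable (fun v => ENNReal.ofReal (f v)) := hfm.ennreal_ofReal
  have hm2 : ∀ k, Measurable (fun v => ENNReal.ofReal (f (v - k))) := fun k =>
    hm1.comp (measurable_id.sub_const k)
  have hEh : gaussianPi V ((fun v => v + h) ⁻¹' E) =
      ∫⁻ v, E.indicator (fun v => ENNReal.ofReal (f (v - h))) v := by
    rw [gaussianPi, withDensity_apply _ (hE.preimage (measurable_add_const h)),
      ← lintegral_indicator (hE.preimage (measurable_add_const h)),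
      ← lintegral_add_right_eq_self (E.indicator (fun v => ENNReal.ofReal (f (v - h)))) h]
    refine lintegral_congr fun v => ?_
    simp only [Set.indicator, add_sub_cancel_right, hf]
    rfl
  have hE0 : gaussianPi V E = ∫⁻ v, E.indicator (fun v => ENNReal.ofReal (f v)) v := by
    rw [gaussianPi, withDensity_apply _ hE, ← lintegral_indicator hE]
  have hf0 : ∫⁻ v, ENNReal.ofReal (f v) = 1 := lintegral_exp_neg_pi_norm_sq
  rw [lintegral_add_left (hm1.indicator hE), lintegral_add_left ((hm2 h).indicator hE),
    lintegral_add_left (hm1.const_mul _), lintegral_const_mul _ (hm2 h),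
    lintegral_const_mul _ hm1, lintegral_const_mul _ (hm2 _), hf1, hf1, hf0, ← hE0, ← hEh,
    mul_one, mul_one, mul_one] at hint
  have hreal := ENNReal.toReal_mono (by finiteness) hint
  rw [ENNReal.toReal_add (by finiteness) (by finiteness),
    ENNReal.toReal_add (by finiteness) (by finiteness),
    ENNReal.toReal_add (by finiteness) (by finiteness), ENNReal.toReal_ofReal (by norm_num),
    ENNReal.toReal_ofReal (by positivity)] at hreal
  have hc' : c ≤ 108 / 100 := by
    have hx : 2 * Real.pi * ‖h‖ ^ 2 ≤ 7 / 100 := by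
      have h1 : ‖h‖ ^ 2 ≤ (1 / 10) ^ 2 := by gcongr
      nlinarith [Real.pi_lt_d2]
    have h2 : c ≤ Real.exp (7 / 100) := Real.exp_le_exp.mpr hx
    have h3 := Real.one_sub_le_exp_neg (7 / 100)
    rw [Real.exp_neg, le_inv_comm₀ (by norm_num) (Real.exp_pos _)] at h3
    refine h2.trans (h3.trans (by norm_num))
  simp only [measureReal_def]
  norm_num at hreal
  linarith

end Gaussian

/-! ### Quadratic forms of a Gaussian matrix -/

section QuadraticForm

variable {n : ℕ}

/-- The rank-one matrix `x xᵀ`, as a vector of the Euclidean space of `n × n` matrices (with the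
Frobenius norm). The quadratic form of `G` at `x` is `inner ℝ (selfTensor x) G`. -/
noncomputable def selfTensor (x : EuclideanSpace ℝ (Fin n)) : EuclideanSpace ℝ (Fin n × Fin n) :=
  WithLp.toLp 2 fun p => x p.1 * x p.2

lemma norm_selfTensor (x : EuclideanSpace ℝ (Fin n)) : ‖selfTensor x‖ = ‖x‖ ^ 2 := by
  have h : ‖selfTensor x‖ ^ 2 = (‖x‖ ^ 2) ^ 2 := by
    rw [EuclideanSpace.real_norm_sq_eq, EuclideanSpace.real_norm_sq_eq, sq (∑ i, x i ^ 2),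
      Finset.sum_mul_sum, Fintype.sum_prod_type]
    simp [selfTensor, mul_pow]
  exact (sq_eq_sq₀ (norm_nonneg _) (by positivity)).mp h

lemma selfTensor_smul (c : ℝ) (x : EuclideanSpace ℝ (Fin n)) :
    selfTensor (c • x) = c ^ 2 • selfTensor x := by
  ext p
  simp [selfTensor]
  ring

lemma selfTensor_add_add_selfTensor_sub (x y : EuclideanSpace ℝ (Fin n)) :
    selfTensor (x + y) + selfTensor (x - y) = (2 : ℝ) • selfTensor x + (2 : ℝ) • selfTensor y := by
  ext p
  simp [selfTensor]
  ring

lemma continuous_selfTensor : Continuous (selfTensor (n := n)) := by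
  unfold selfTensor
  fun_prop

/-- The largest value of a quadratic form on the unit sphere bounds the form everywhere. -/
lemma exists_unit_forall_abs_inner_selfTensor_le (G : EuclideanSpace ℝ (Fin n × Fin n))
    {R : ℝ} {x₀ : EuclideanSpace ℝ (Fin n)} (hx₀ : R * ‖x₀‖ ^ 2 < |inner ℝ (selfTensor x₀) G|) :
    ∃ x : EuclideanSpace ℝ (Fin n), ‖x‖ = 1 ∧ R < |inner ℝ (selfTensor x) G| ∧
      ∀ u, |inner ℝ (selfTensor u) G| ≤ |inner ℝ (selfTensor x) G| * ‖u‖ ^ 2 := by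
  have hne : x₀ ≠ 0 := by
    rintro rfl
    have h0 : selfTensor (0 : EuclideanSpace ℝ (Fin n)) = 0 := by
      rw [← norm_eq_zero, norm_selfTensor]; simp
    simp [h0] at hx₀
  have hunit : ∀ u : EuclideanSpace ℝ (Fin n), u ≠ 0 → ‖‖u‖⁻¹ • u‖ = 1 := fun u hu =>
    norm_smul_inv_norm (𝕜 := ℝ) hu
  have hscale : ∀ u : EuclideanSpace ℝ (Fin n), u ≠ 0 →
      |inner ℝ (selfTensor u) G| = |inner ℝ (selfTensor (‖u‖⁻¹ • u)) G| * ‖u‖ ^ 2 := by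
    intro u hu
    have hu' : 0 < ‖u‖ := norm_pos_iff.mpr hu
    rw [selfTensor_smul, real_inner_smul_left, abs_mul,
      abs_of_nonneg (show (0 : ℝ) ≤ ‖u‖⁻¹ ^ 2 by positivity)]
    field_simp
  obtain ⟨x, hx, hmax⟩ := (isCompact_sphere (0 : EuclideanSpace ℝ (Fin n)) 1).exists_isMaxOn
    ⟨‖x₀‖⁻¹ • x₀, by simpa using hunit x₀ hne⟩
    (f := fun x => |inner ℝ (selfTensor x) G|)
    ((continuous_selfTensor.inner continuous_const).abs.continuousOn)
  have hle : ∀ u, |inner ℝ (selfTensor u) G| ≤ |inner ℝ (selfTensor x) G| * ‖u‖ ^ 2 := by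
    intro u
    by_cases hu : u = 0
    · have h0 : selfTensor (0 : EuclideanSpace ℝ (Fin n)) = 0 := by
        rw [← norm_eq_zero, norm_selfTensor]; simp
      simp [hu, h0]
    · rw [hscale u hu]
      exact mul_le_mul_of_nonneg_right (hmax (by simpa using hunit u hu)) (by positivity)
  refine ⟨x, by simpa using hx, ?_, hle⟩
  have hpos : 0 < ‖x₀‖ := norm_pos_iff.mpr hne
  exact lt_of_mul_lt_mul_right (hx₀.trans_le (hle x₀)) (by positivity)

/-- An exponential moment of the quadratic form of `G` over the unit ball. -/
noncomputable def ballMoment (θ : ℝ) (G : EuclideanSpace ℝ (Fin n × Fin n)) : ENNReal :=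
  ∫⁻ y in Metric.closedBall (0 : EuclideanSpace ℝ (Fin n)) 1,
    (ENNReal.ofReal (Real.exp (inner ℝ (θ • selfTensor y) G)) +
      ENNReal.ofReal (Real.exp (inner ℝ ((-θ) • selfTensor y) G)))

/-- If the form exceeds `R` at some direction, then it exceeds `R / 2` on half of a ball of radius
`1 / 4` around `3 / 4` of a maximizing unit vector `x`: by the parallelogram law,
`q (3/4 x + u) + q (3/4 x - u) = 9/8 q x + 2 q u`, of absolute value at least `|q x|`. -/
lemma le_ballMoment {θ R : ℝ} (hθ : 0 ≤ θ) {G : EuclideanSpace ℝ (Fin n × Fin n)}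
    {x₀ : EuclideanSpace ℝ (Fin n)} (hx₀ : R * ‖x₀‖ ^ 2 < |inner ℝ (selfTensor x₀) G|) :
    ENNReal.ofReal (Real.exp (θ * R / 2)) *
      volume (Metric.closedBall (0 : EuclideanSpace ℝ (Fin n)) (1 / 4)) ≤
        2 * ballMoment θ G := by
  obtain ⟨x, hx1, hRx, hle⟩ := exists_unit_forall_abs_inner_selfTensor_le G hx₀
  set g : EuclideanSpace ℝ (Fin n) → ENNReal := fun y =>
    ENNReal.ofReal (Real.exp (inner ℝ (θ • selfTensor y) G)) +
      ENNReal.ofReal (Real.exp (inner ℝ ((-θ) • selfTensor y) G)) with hg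
  have hgm : Measurable g := by
    have := continuous_selfTensor (n := n)
    have h1 : Continuous fun y => Real.exp (inner ℝ (θ • selfTensor (n := n) y) G) := by fun_prop
    have h2 : Continuous fun y => Real.exp (inner ℝ ((-θ) • selfTensor (n := n) y) G) := by
      fun_prop
    exact h1.measurable.ennreal_ofReal.add h2.measurable.ennreal_ofReal
  have hgle : ∀ y, ENNReal.ofReal (Real.exp (θ * |inner ℝ (selfTensor y) G|)) ≤ g y := by
    intro y
    simp only [hg, real_inner_smul_left]
    rcases abs_choice (inner ℝ (selfTensor y) G) with h | h <;> rw [h]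
    · exact le_self_add
    · rw [mul_neg, ← neg_mul]
      exact le_add_self
  set p : EuclideanSpace ℝ (Fin n) := (3 / 4 : ℝ) • x with hp
  have hpn : ‖p‖ = 3 / 4 := by rw [hp, norm_smul, hx1]; norm_num
  set B := Metric.closedBall (0 : EuclideanSpace ℝ (Fin n)) (1 / 4) with hB
  have hBm : MeasurableSet B := Metric.isClosed_closedBall.measurableSet
  -- the integrals over `p + u` and over `p - u` are both at most the integral over the unit ball
  have hplus : ∫⁻ u in B, g (p + u) ≤ ballMoment θ G := by
    rw [ballMoment, ← lintegral_indicator hBm,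
      ← lintegral_indicator Metric.isClosed_closedBall.measurableSet,
      ← lintegral_add_left_eq_self (Set.indicator (Metric.closedBall 0 1) g) p]
    refine lintegral_mono fun u => ?_
    by_cases hu : u ∈ B
    · have hu' : p + u ∈ Metric.closedBall (0 : EuclideanSpace ℝ (Fin n)) 1 := by
        rw [hB, mem_closedBall_zero_iff] at hu
        rw [mem_closedBall_zero_iff]
        exact (norm_add_le _ _).trans (by rw [hpn]; linarith)
      rw [Set.indicator_of_mem hu, Set.indicator_of_mem hu']
    · rw [Set.indicator_of_notMem hu]
      exact zero_le
  have hminus : ∫⁻ u in B, g (p - u) ≤ ballMoment θ G := by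
    refine le_trans (le_of_eq ?_) hplus
    rw [← lintegral_indicator hBm, ← lintegral_indicator hBm, ← lintegral_neg_eq_self]
    refine lintegral_congr fun u => ?_
    have hiff : -u ∈ B ↔ u ∈ B := by simp [hB]
    by_cases hu : u ∈ B
    · rw [Set.indicator_of_mem hu, Set.indicator_of_mem (hiff.mpr hu), sub_neg_eq_add]
    · rw [Set.indicator_of_notMem hu, Set.indicator_of_notMem (fun h => hu (hiff.mp h))]
  have hpt : ∀ u ∈ B, ENNReal.ofReal (Real.exp (θ * R / 2)) ≤ g (p + u) + g (p - u) := by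
    intro u hu
    rw [hB, mem_closedBall_zero_iff] at hu
    have hpar := congrArg (fun T => inner ℝ T G) (selfTensor_add_add_selfTensor_sub p u)
    simp only [inner_add_left, real_inner_smul_left, hp, selfTensor_smul] at hpar
    rw [← hp] at hpar
    have hu2 : ‖u‖ ^ 2 ≤ 1 / 16 := by nlinarith [norm_nonneg u]
    have hqu : |inner ℝ (selfTensor u) G| ≤ |inner ℝ (selfTensor x) G| * (1 / 16) :=
      (hle u).trans (by gcongr)
    have hor : R / 2 ≤ |inner ℝ (selfTensor (p + u)) G| ∨
        R / 2 ≤ |inner ℝ (selfTensor (p - u)) G| := by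
      by_contra! hcon
      have h1 := abs_lt.mp hcon.1
      have h2 := abs_lt.mp hcon.2
      have h3 := abs_le.mp hqu
      rcases abs_cases (inner ℝ (selfTensor x) G) with h4 | h4 <;> linarith
    rcases hor with h | h
    · refine le_trans ?_ ((hgle (p + u)).trans le_self_add)
      rw [mul_div_assoc]
      gcongr
    · refine le_trans ?_ ((hgle (p - u)).trans le_add_self)
      rw [mul_div_assoc]
      gcongr
  calc ENNReal.ofReal (Real.exp (θ * R / 2)) * volume B
      = ∫⁻ _ in B, ENNReal.ofReal (Real.exp (θ * R / 2)) := (setLIntegral_const _ _).symm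
    _ ≤ ∫⁻ u in B, (g (p + u) + g (p - u)) := setLIntegral_mono' hBm hpt
    _ = (∫⁻ u in B, g (p + u)) + ∫⁻ u in B, g (p - u) :=
        lintegral_add_left (hgm.comp (measurable_const_add p)) _
    _ ≤ ballMoment θ G + ballMoment θ G := add_le_add hplus hminus
    _ = 2 * ballMoment θ G := (two_mul _).symm

lemma measurable_uncurry_exp_inner_smul_selfTensor (θ : ℝ) :
    Measurable (Function.uncurry fun (G : EuclideanSpace ℝ (Fin n × Fin n))
      (y : EuclideanSpace ℝ (Fin n)) =>
        ENNReal.ofReal (Real.exp (inner ℝ (θ • selfTensor y) G))) := by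
  have := continuous_selfTensor (n := n)
  have h : Continuous (Function.uncurry fun (G : EuclideanSpace ℝ (Fin n × Fin n))
      (y : EuclideanSpace ℝ (Fin n)) => Real.exp (inner ℝ (θ • selfTensor y) G)) := by
    unfold Function.uncurry
    fun_prop
  exact h.measurable.ennreal_ofReal

lemma measurable_ballMoment (θ : ℝ) : Measurable (ballMoment (n := n) θ) :=
  ((measurable_uncurry_exp_inner_smul_selfTensor θ).add
    (measurable_uncurry_exp_inner_smul_selfTensor (-θ))).lintegral_prod_right

lemma lintegral_ballMoment_le (θ : ℝ) :
    ∫⁻ G, ballMoment θ G ∂gaussianPi (EuclideanSpace ℝ (Fin n × Fin n)) ≤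
      2 * ENNReal.ofReal (Real.exp (θ ^ 2 / (4 * Real.pi))) *
        volume (Metric.closedBall (0 : EuclideanSpace ℝ (Fin n)) 1) := by
  unfold ballMoment
  rw [lintegral_lintegral_swap ((measurable_uncurry_exp_inner_smul_selfTensor θ).add
    (measurable_uncurry_exp_inner_smul_selfTensor (-θ))).aemeasurable, ← setLIntegral_const]
  refine setLIntegral_mono' Metric.isClosed_closedBall.measurableSet fun y hy => ?_
  rw [mem_closedBall_zero_iff] at hy
  have hb : ∀ c : ℝ, c ^ 2 = θ ^ 2 →
      ENNReal.ofReal (Real.exp (‖c • selfTensor y‖ ^ 2 / (4 * Real.pi))) ≤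
        ENNReal.ofReal (Real.exp (θ ^ 2 / (4 * Real.pi))) := by
    intro c hc
    have h1 : ‖c • selfTensor y‖ ^ 2 ≤ θ ^ 2 := by
      rw [norm_smul, norm_selfTensor, mul_pow, Real.norm_eq_abs, sq_abs, hc]
      exact mul_le_of_le_one_right (sq_nonneg _)
        (pow_le_one₀ (by positivity) (pow_le_one₀ (norm_nonneg _) hy))
    have := Real.pi_pos
    gcongr
  rw [lintegral_add_left (by fun_prop), lintegral_exp_inner_gaussianPi,
    lintegral_exp_inner_gaussianPi, two_mul]
  exact add_le_add (hb θ rfl) (hb (-θ) (neg_sq θ))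

/-- The quadratic form of a Gaussian matrix is bounded by `3 √n` on the unit sphere, except with
probability at most `1 / 20`. -/
lemma gaussianPi_exists_lt_abs_inner_selfTensor_le (hn : 1 ≤ n) :
    (gaussianPi (EuclideanSpace ℝ (Fin n × Fin n))).real
      {G | ∃ x, 3 * √n * ‖x‖ ^ 2 < |inner ℝ (selfTensor x) G|} ≤ 1 / 20 := by
  have hpi := Real.pi_pos
  set R : ℝ := 3 * √n with hR
  have hR2 : R ^ 2 = 9 * n := by rw [hR, mul_pow, Real.sq_sqrt (Nat.cast_nonneg n)]; norm_num
  -- the exponent that optimizes `θ ^ 2 / (4 * π) - θ * R / 2`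
  set θ : ℝ := Real.pi * R with hθ
  set μ := gaussianPi (EuclideanSpace ℝ (Fin n × Fin n)) with hμ
  set v := volume (Metric.closedBall (0 : EuclideanSpace ℝ (Fin n)) 1) with hv
  have hv0 : v ≠ 0 := (Metric.measure_closedBall_pos _ _ one_pos).ne'
  have hvt : v ≠ ⊤ := measure_closedBall_lt_top.ne
  have hvol : volume (Metric.closedBall (0 : EuclideanSpace ℝ (Fin n)) (1 / 4)) =
      ENNReal.ofReal ((1 / 4) ^ n) * v := by
    rw [Measure.addHaar_closedBall' _ _ (by norm_num), finrank_euclideanSpace_fin]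
  set Bad := {G : EuclideanSpace ℝ (Fin n × Fin n) |
    ∃ x, R * ‖x‖ ^ 2 < |inner ℝ (selfTensor x) G|} with hBad
  set a : ENNReal := ENNReal.ofReal (Real.exp (θ * R / 2)) * (ENNReal.ofReal ((1 / 4) ^ n) * v)
    with ha
  have hsub : Bad ⊆ {G | a ≤ 2 * ballMoment θ G} := by
    rintro G ⟨x, hx⟩
    have := le_ballMoment (θ := θ) (by positivity) hx
    rwa [hvol] at this
  have hmar : a * μ Bad ≤
      2 * (2 * ENNReal.ofReal (Real.exp (θ ^ 2 / (4 * Real.pi))) * v) := by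
    calc a * μ Bad ≤ a * μ {G | a ≤ 2 * ballMoment θ G} := by gcongr
      _ ≤ ∫⁻ G, 2 * ballMoment θ G ∂μ :=
        mul_meas_ge_le_lintegral ((measurable_ballMoment θ).const_mul 2) a
      _ = 2 * ∫⁻ G, ballMoment θ G ∂μ := lintegral_const_mul _ (measurable_ballMoment θ)
      _ ≤ _ := by gcongr; exact lintegral_ballMoment_le θ
  have hvr : 0 < v.toReal := ENNReal.toReal_pos hv0 hvt
  clear_value v
  have hreal := ENNReal.toReal_mono (by finiteness) hmar
  simp only [ha, ENNReal.toReal_mul, ENNReal.toReal_ofReal (Real.exp_pos _).le,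
    ENNReal.toReal_ofReal (show (0 : ℝ) ≤ (1 / 4) ^ n by positivity),
    ENNReal.toReal_ofNat] at hreal
  rw [← measureReal_def μ Bad] at hreal
  have e1 : θ * R / 2 = Real.pi * (9 * n) / 4 + Real.pi * (9 * n) / 4 := by
    rw [hθ, mul_assoc, ← sq, hR2]; ring
  have e2 : θ ^ 2 / (4 * Real.pi) = Real.pi * (9 * n) / 4 := by
    rw [hθ, mul_pow, hR2]; field_simp
  rw [e1, e2, Real.exp_add] at hreal
  set e := Real.exp (Real.pi * (9 * n) / 4) with he
  have hep : 0 < e := Real.exp_pos _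
  have h1 : e * (1 / 4) ^ n * μ.real Bad ≤ 4 := by
    have h : e * v.toReal * (e * (1 / 4) ^ n * μ.real Bad) ≤ e * v.toReal * 4 := by
      linarith
    exact le_of_mul_le_mul_left h (by positivity)
  have h2 : (80 : ℝ) ≤ e * (1 / 4) ^ n := by
    have h3 : (320 : ℝ) ^ n ≤ e := by
      have h4 : (320 : ℝ) ≤ Real.exp 6 := by
        have h5 : Real.exp 6 = Real.exp 1 ^ 6 := by rw [← Real.exp_nat_mul]; norm_num
        have h6 : (2.7 : ℝ) ≤ Real.exp 1 := by linarith [Real.exp_one_gt_d9]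
        rw [h5]
        calc (320 : ℝ) ≤ 2.7 ^ 6 := by norm_num
          _ ≤ _ := by gcongr
      calc (320 : ℝ) ^ n ≤ Real.exp 6 ^ n := by gcongr
        _ = Real.exp (n * 6) := (Real.exp_nat_mul _ _).symm
        _ ≤ e := by
          rw [he]
          apply Real.exp_le_exp.mpr
          have : (0 : ℝ) ≤ n := Nat.cast_nonneg n
          nlinarith [Real.pi_gt_three]
    calc (80 : ℝ) = 80 ^ 1 := by norm_num
      _ ≤ 80 ^ n := pow_le_pow_right₀ (by norm_num) hn
      _ = 320 ^ n * (1 / 4) ^ n := by rw [← mul_pow]; norm_num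
      _ ≤ _ := by gcongr
  have h7 : 80 * μ.real Bad ≤ 4 := (mul_le_mul_of_nonneg_right h2 measureReal_nonneg).trans h1
  linarith

end QuadraticForm

/-! ### The hard distribution and the directions hidden from the queries -/

section Prior

variable {n : ℕ}

/-- An `n × n` matrix as a vector of the Euclidean space of matrices (Frobenius norm). -/
noncomputable def matrixVec (D : Matrix (Fin n) (Fin n) ℝ) : EuclideanSpace ℝ (Fin n × Fin n) :=
  WithLp.toLp 2 fun p => D p.1 p.2

/-- The symmetric part of `G`, shifted by `3 √n` times the identity. For Gaussian `G` this is the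
hard input: it is positive semidefinite with high probability. -/
noncomputable def shiftedSymm (G : EuclideanSpace ℝ (Fin n × Fin n)) :
    Matrix (Fin n) (Fin n) ℝ :=
  Matrix.of fun i j => (if i = j then 3 * √n else 0) + (G (i, j) + G (j, i)) / 2

lemma shiftedSymm_add_smul_matrixVec (G : EuclideanSpace ℝ (Fin n × Fin n)) (s : ℝ)
    {D : Matrix (Fin n) (Fin n) ℝ} (hD : Dᵀ = D) :
    shiftedSymm (G + s • matrixVec D) = shiftedSymm G + s • D := by
  ext i j
  have hij : D j i = D i j := congrFun (congrFun hD i) j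
  simp [shiftedSymm, matrixVec, hij]
  ring

lemma dotProduct_shiftedSymm_mulVec (G : EuclideanSpace ℝ (Fin n × Fin n)) (x : Fin n → ℝ) :
    x ⬝ᵥ shiftedSymm G *ᵥ x =
      3 * √n * ‖WithLp.toLp 2 x‖ ^ 2 + inner ℝ (selfTensor (WithLp.toLp 2 x)) G := by
  have h1 : inner ℝ (selfTensor (WithLp.toLp 2 x)) G = ∑ i, ∑ j, x i * x j * G (i, j) := by
    simp [selfTensor, PiLp.inner_apply, Fintype.sum_prod_type, mul_comm]
  have h2 : ∑ i, ∑ j, x i * x j * G (i, j) = ∑ i, ∑ j, x i * x j * G (j, i) := by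
    rw [Finset.sum_comm]
    exact Finset.sum_congr rfl fun i _ => Finset.sum_congr rfl fun j _ => by ring
  have h3 : x ⬝ᵥ shiftedSymm G *ᵥ x = ∑ i, ∑ j, ((if i = j then 3 * √n * x i ^ 2 else 0) +
      (x i * x j * G (i, j) + x i * x j * G (j, i)) / 2) := by
    simp only [dotProduct, Matrix.mulVec, Finset.mul_sum, shiftedSymm, Matrix.of_apply]
    refine Finset.sum_congr rfl fun i _ => Finset.sum_congr rfl fun j _ => ?_
    split_ifs with h
    · subst h; ring
    · ring
  rw [h3, h1, EuclideanSpace.real_norm_sq_eq]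
  simp only [Finset.sum_add_distrib, ← Finset.sum_div, ← h2]
  simp [Finset.mul_sum]

lemma posSemidef_shiftedSymm {G : EuclideanSpace ℝ (Fin n × Fin n)}
    (hG : ∀ x, |inner ℝ (selfTensor x) G| ≤ 3 * √n * ‖x‖ ^ 2) : (shiftedSymm G).PosSemidef := by
  refine Matrix.PosSemidef.of_dotProduct_mulVec_nonneg ?_ fun x => ?_
  · ext i j
    simp [shiftedSymm, eq_comm, add_comm]
  · rw [star_trivial, dotProduct_shiftedSymm_mulVec]
    linarith [(abs_le.mp (hG (WithLp.toLp 2 x))).1]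

lemma trace_shiftedSymm_le {G : EuclideanSpace ℝ (Fin n × Fin n)}
    (hG : ∀ x, |inner ℝ (selfTensor x) G| ≤ 3 * √n * ‖x‖ ^ 2) :
    (shiftedSymm G).trace ≤ n * (6 * √n) := by
  have hdiag : ∀ i, shiftedSymm G i i ≤ 6 * √n := by
    intro i
    have h := dotProduct_shiftedSymm_mulVec G (Pi.single i 1)
    have h' := (abs_le.mp (hG (WithLp.toLp 2 (Pi.single i 1)))).2
    have hn : ‖(WithLp.toLp 2 (Pi.single i 1) : EuclideanSpace ℝ (Fin n))‖ = 1 := by simp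
    rw [hn] at h h'
    rw [Matrix.mulVec_single_one, single_one_dotProduct, Matrix.col_apply] at h
    linarith
  calc (shiftedSymm G).trace ≤ ∑ _i : Fin n, 6 * √n := Finset.sum_le_sum fun i _ => hdiag i
    _ = n * (6 * √n) := by simp

lemma measurable_shiftedSymm (i j : Fin n) :
    Measurable fun G : EuclideanSpace ℝ (Fin n × Fin n) => shiftedSymm G i j := by
  simp only [shiftedSymm, Matrix.of_apply]
  fun_prop

/-- The orthogonal projection onto the complement of the span of `m` vectors, as a matrix: it has
trace at least `n - m`, and its squared Frobenius norm equals its trace. -/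
lemma exists_projection_mulVec_eq_zero {m : ℕ} (q : Fin m → Fin n → ℝ) :
    ∃ D : Matrix (Fin n) (Fin n) ℝ, Dᵀ = D ∧ (∀ i, D *ᵥ q i = 0) ∧ (n : ℝ) - m ≤ D.trace ∧
      D.trace ≤ n ∧ ‖matrixVec D‖ ^ 2 = D.trace := by
  set W : Submodule ℝ (EuclideanSpace ℝ (Fin n)) :=
    Submodule.span ℝ (Set.range fun i => WithLp.toLp 2 (q i)) with hW
  set k := Module.finrank ℝ Wᗮ with hk
  let b : OrthonormalBasis (Fin k) ℝ Wᗮ := stdOrthonormalBasis ℝ Wᗮ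
  let B : Matrix (Fin n) (Fin k) ℝ := Matrix.of fun a j => (b j : EuclideanSpace ℝ (Fin n)) a
  have hBB : Bᵀ * B = 1 := by
    ext i j
    have h := orthonormal_iff_ite.mp b.orthonormal i j
    rw [Submodule.coe_inner, PiLp.inner_apply] at h
    rw [Matrix.one_apply, ← h]
    simp only [B, Matrix.mul_apply, Matrix.transpose_apply, Matrix.of_apply, RCLike.inner_apply,
      conj_trivial]
    exact Finset.sum_congr rfl fun a _ => mul_comm _ _
  have htr : (B * Bᵀ).trace = k := by
    rw [Matrix.trace_mul_comm, hBB, Matrix.trace_one, Fintype.card_fin]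
  have hsum : Module.finrank ℝ W + k = n := by
    rw [hk, Submodule.finrank_add_finrank_orthogonal, finrank_euclideanSpace_fin]
  have hWm : Module.finrank ℝ W ≤ m := by
    have := finrank_range_le_card (R := ℝ)
      (fun i => (WithLp.toLp 2 (q i) : EuclideanSpace ℝ (Fin n)))
    rwa [Fintype.card_fin] at this
  have hsymm : (B * Bᵀ)ᵀ = B * Bᵀ := by rw [Matrix.transpose_mul, Matrix.transpose_transpose]
  refine ⟨B * Bᵀ, hsymm, fun i => ?_, ?_, ?_, ?_⟩
  · have h0 : Bᵀ *ᵥ q i = 0 := by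
      ext j
      have hq : (WithLp.toLp 2 (q i) : EuclideanSpace ℝ (Fin n)) ∈ W :=
        Submodule.subset_span ⟨i, rfl⟩
      have h := (Submodule.mem_orthogonal W _).mp (b j).2 _ hq
      rw [PiLp.inner_apply] at h
      simpa [B, Matrix.mulVec, dotProduct] using h
    rw [← Matrix.mulVec_mulVec, h0, Matrix.mulVec_zero]
  · rw [htr, sub_le_iff_le_add]
    exact_mod_cast (by omega : n ≤ k + m)
  · rw [htr]
    exact_mod_cast (by omega : k ≤ n)
  · have hidem : B * Bᵀ * (B * Bᵀ) = B * Bᵀ := by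
      rw [Matrix.mul_assoc, ← Matrix.mul_assoc Bᵀ, hBB, Matrix.one_mul]
    conv_rhs => rw [← hidem]
    rw [EuclideanSpace.real_norm_sq_eq, Fintype.sum_prod_type]
    simp only [Matrix.trace, Matrix.diag, Matrix.mul_apply (M := B * Bᵀ)]
    refine Finset.sum_congr rfl fun i _ => Finset.sum_congr rfl fun j _ => ?_
    have hij : (B * Bᵀ) j i = (B * Bᵀ) i j := congrFun (congrFun hsymm i) j
    rw [hij, ← sq]
    rfl

end Prior

/-! ### Algorithms -/

namespace NonadaptiveAlgorithm

variable {Ω : Type*} [MeasurableSpace Ω] {d n m : ℕ}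

/-- The `d × n` matrix that embeds `ℝⁿ` into the first `n` coordinates of `ℝᵈ`. -/
def padding (h : n ≤ d) : Matrix (Fin d) (Fin n) ℝ :=
  Matrix.of fun a i => if a = Fin.castLE h i then 1 else 0

lemma transpose_padding_mul_padding (h : n ≤ d) : (padding h)ᵀ * padding h = 1 := by
  ext i j
  simp [padding, Matrix.mul_apply, Matrix.one_apply, (Fin.castLE_injective h).eq_iff, eq_comm]

lemma measurable_mulVec_const {p q : ℕ} (M : Matrix (Fin p) (Fin q) ℝ) :
    Measurable fun v : Fin q → ℝ => M *ᵥ v := by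
  refine measurable_pi_lambda _ fun i => ?_
  simp only [Matrix.mulVec, dotProduct]
  fun_prop

/-- An algorithm for `d × d` matrices, run on `n × n` matrices that are padded with zeros. -/
def restrict (alg : NonadaptiveAlgorithm Ω d m) (h : n ≤ d) : NonadaptiveAlgorithm Ω n m where
  query ω i := (padding h)ᵀ *ᵥ alg.query ω i
  measurable_query := measurable_pi_lambda _ fun i =>
    (measurable_mulVec_const _).comp ((measurable_pi_apply i).comp alg.measurable_query)
  estimate p := alg.estimate (p.1, fun i => padding h *ᵥ p.2 i)
  measurable_estimate := alg.measurable_estimate.comp <| measurable_fst.prodMk <|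
    measurable_pi_lambda _ fun i =>
      (measurable_mulVec_const _).comp ((measurable_pi_apply i).comp measurable_snd)

lemma EstimatesTrace.restrict {alg : NonadaptiveAlgorithm Ω d m} {P : Measure Ω} {ε : ℝ}
    (halg : alg.EstimatesTrace P ε) (h : n ≤ d) : (alg.restrict h).EstimatesTrace P ε := by
  intro A hA
  have hpos : (padding h * A * (padding h)ᵀ).PosSemidef := by
    have := hA.mul_mul_conjTranspose_same (padding h)
    rwa [Matrix.conjTranspose_eq_transpose_of_trivial] at this
  have htr : (padding h * A * (padding h)ᵀ).trace = A.trace := by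
    rw [Matrix.trace_mul_comm, ← Matrix.mul_assoc, transpose_padding_mul_padding, Matrix.one_mul]
  have hout : ∀ ω, alg.output (padding h * A * (padding h)ᵀ) ω = (alg.restrict h).output A ω := by
    intro ω
    simp only [output, NonadaptiveAlgorithm.restrict, Matrix.mulVec_mulVec, Matrix.mul_assoc]
  have := halg _ hpos
  simpa only [htr, hout] using this

/-- Without queries the output does not depend on the input, so the zero matrix and the identity
cannot both be handled. -/
lemma EstimatesTrace.queries_pos {alg : NonadaptiveAlgorithm Ω d m} {P : Measure Ω}
    [IsProbabilityMeasure P] {ε : ℝ} (halg : alg.EstimatesTrace P ε) (hε : ε < 1) (hd : 0 < d) :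
    0 < m := by
  by_contra hm
  obtain rfl : m = 0 := by omega
  have h0 := halg 0 Matrix.PosSemidef.zero
  have h1 := halg 1 Matrix.PosSemidef.one
  have hout : ∀ ω, alg.output 1 ω = alg.output 0 ω := fun ω => by
    simp only [output]
    congr
    exact Subsingleton.elim _ _
  have hmeas : Measurable fun ω => alg.output 0 ω := by
    simp only [output, Matrix.zero_mulVec]
    exact alg.measurable_estimate.comp (measurable_id.prodMk measurable_const)
  simp only [hout, Matrix.trace_zero, mul_zero, Matrix.trace_one, Fintype.card_fin] at h0 h1
  have hdisj : Disjoint {ω | 0 ≤ alg.output 0 ω ∧ alg.output 0 ω ≤ 0}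
      {ω | (1 - ε) * d ≤ alg.output 0 ω ∧ alg.output 0 ω ≤ (1 + ε) * d} := by
    rw [Set.disjoint_left]
    rintro ω ⟨-, ha⟩ ⟨hb, -⟩
    have : 0 < (1 - ε) * d := mul_pos (by linarith) (by exact_mod_cast hd)
    linarith
  have hle := measureReal_union (μ := P) hdisj
    ((measurableSet_le measurable_const hmeas).inter (measurableSet_le hmeas measurable_const))
  have := measureReal_le_one (μ := P) (s := {ω | 0 ≤ alg.output 0 ω ∧ alg.output 0 ω ≤ 0} ∪
      {ω | (1 - ε) * d ≤ alg.output 0 ω ∧ alg.output 0 ω ≤ (1 + ε) * d})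
  linarith

/-- The pairs of coins and Gaussian matrices for which the estimate is accurate. -/
def successSet (alg : NonadaptiveAlgorithm Ω n m) (ε : ℝ) :
    Set (Ω × EuclideanSpace ℝ (Fin n × Fin n)) :=
  {p | (1 - ε) * (shiftedSymm p.2).trace ≤ alg.output (shiftedSymm p.2) p.1 ∧
    alg.output (shiftedSymm p.2) p.1 ≤ (1 + ε) * (shiftedSymm p.2).trace}

lemma measurableSet_successSet (alg : NonadaptiveAlgorithm Ω n m) (ε : ℝ) :
    MeasurableSet (alg.successSet ε) := by
  have hentry : ∀ i j, Measurable fun p : Ω × EuclideanSpace ℝ (Fin n × Fin n) =>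
      shiftedSymm p.2 i j := fun i j => (measurable_shiftedSymm i j).comp measurable_snd
  have hq : ∀ i j, Measurable fun p : Ω × EuclideanSpace ℝ (Fin n × Fin n) =>
      alg.query p.1 i j := fun i j =>
    (measurable_pi_apply j).comp ((measurable_pi_apply i).comp
      (alg.measurable_query.comp measurable_fst))
  have htr : Measurable fun p : Ω × EuclideanSpace ℝ (Fin n × Fin n) =>
      (shiftedSymm p.2).trace := by
    simp only [Matrix.trace, Matrix.diag]
    exact Finset.measurable_sum _ fun i _ => hentry i i
  have hout : Measurable fun p : Ω × EuclideanSpace ℝ (Fin n × Fin n) =>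
      alg.output (shiftedSymm p.2) p.1 := by
    refine alg.measurable_estimate.comp (measurable_fst.prodMk ?_)
    refine measurable_pi_lambda _ fun i => measurable_pi_lambda _ fun j => ?_
    simp only [Matrix.mulVec, dotProduct]
    exact Finset.measurable_sum _ fun k _ => (hentry j k).mul (hq i k)
  exact (measurableSet_le (htr.const_mul _) hout).inter (measurableSet_le hout (htr.const_mul _))

/-- For fixed coins the estimate is accurate for at most a `27 / 40` fraction of the matrices. The
translation by a multiple of the projection onto the complement of the queries preserves the
answers, but moves the trace so much that the estimate is not accurate both before and after. -/
lemma gaussianPi_successSet_le (alg : NonadaptiveAlgorithm Ω n m) {ε : ℝ} (hε2 : ε ≤ 1 / 2)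
    (hn : 1 ≤ n) (hmn : 2 * m ≤ n) (hεn : 480 * ε * n < 1) (hε0 : 0 < ε) (ω : Ω) :
    (gaussianPi (EuclideanSpace ℝ (Fin n × Fin n))).real (Prod.mk ω ⁻¹' alg.successSet ε) ≤
      27 / 40 := by
  set μ := gaussianPi (EuclideanSpace ℝ (Fin n × Fin n)) with hμ
  set E := Prod.mk ω ⁻¹' alg.successSet ε with hE
  have hEm : MeasurableSet E := measurable_prodMk_left (alg.measurableSet_successSet ε)
  obtain ⟨D, hDs, hDq, hDt, hDn, hDf⟩ := exists_projection_mulVec_eq_zero (alg.query ω)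
  have hn0 : (0 : ℝ) < n := by exact_mod_cast hn
  have hr : 0 < √(n : ℝ) := Real.sqrt_pos.mpr hn0
  have hrr : √(n : ℝ) * √n = n := Real.mul_self_sqrt hn0.le
  set s : ℝ := 1 / (10 * √n) with hs
  have hsr : s * √n = 1 / 10 := by rw [hs]; field_simp
  have hsp : 0 < s := by positivity
  set h := s • matrixVec D with hh
  have hnorm : ‖h‖ ≤ 1 / 10 := by
    rw [hh, norm_smul, Real.norm_of_nonneg hsp.le, ← hsr]
    gcongr
    exact Real.le_sqrt_of_sq_le (hDf.trans_le hDn)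
  set Bad := {G : EuclideanSpace ℝ (Fin n × Fin n) |
    ∃ x, 3 * √n * ‖x‖ ^ 2 < |inner ℝ (selfTensor x) G|} with hBad
  have hbad : μ.real Bad ≤ 1 / 20 := gaussianPi_exists_lt_abs_inner_selfTensor_le hn
  have hinter : E ∩ (fun G => G + h) ⁻¹' E ⊆ Bad := by
    rintro G ⟨hG1, hG2⟩
    by_contra hG
    have hG' : ∀ x, |inner ℝ (selfTensor x) G| ≤ 3 * √n * ‖x‖ ^ 2 := by
      simpa [hBad] using hG
    have hT := trace_shiftedSymm_le hG'
    have hout : alg.output (shiftedSymm (G + h)) ω = alg.output (shiftedSymm G) ω := by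
      simp only [output, hh, shiftedSymm_add_smul_matrixVec G s hDs, Matrix.add_mulVec,
        Matrix.smul_mulVec, hDq, smul_zero, add_zero]
    have htr : (shiftedSymm (G + h)).trace = (shiftedSymm G).trace + s * D.trace := by
      rw [hh, shiftedSymm_add_smul_matrixVec G s hDs, Matrix.trace_add, Matrix.trace_smul,
        smul_eq_mul]
    have h1 : alg.output (shiftedSymm G) ω ≤ (1 + ε) * (shiftedSymm G).trace := hG1.2
    have h2 : (1 - ε) * (shiftedSymm (G + h)).trace ≤ alg.output (shiftedSymm (G + h)) ω := hG2.1
    rw [hout, htr] at h2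
    have hm2 : (m : ℝ) ≤ n / 2 := by
      rw [le_div_iff₀ two_pos, mul_comm]; exact_mod_cast hmn
    have h3 : s * (n / 2) ≤ s * D.trace := by gcongr; linarith
    have h4 : (1 - ε) * (s * D.trace) ≤ 2 * ε * (n * (6 * √n)) := by nlinarith
    have h5 : 1 / 2 * (s * (n / 2)) ≤ (1 - ε) * (s * D.trace) := by
      have : 0 ≤ s * (n / 2 : ℝ) := by positivity
      nlinarith
    -- after multiplication by `√n` both sides are free of square roots
    have h6 := mul_le_mul_of_nonneg_right (h5.trans h4) hr.le
    have h7 : 1 / 2 * (s * (n / 2)) * √n = n / 40 := by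
      linear_combination (n / 4 : ℝ) * hsr
    have h8 : 2 * ε * (n * (6 * √n)) * √n = 12 * ε * n * n := by
      linear_combination (12 * ε * n : ℝ) * hrr
    rw [h7, h8] at h6
    nlinarith
  have hshift := gaussianPi_le_preimage_add hEm hnorm
  have hui := measureReal_union_add_inter (μ := μ) (s := E)
    (hEm.preimage (measurable_add_const h))
  have hle1 : μ.real (E ∪ (fun G => G + h) ⁻¹' E) ≤ 1 := measureReal_le_one
  have hle2 : μ.real (E ∩ (fun G => G + h) ⁻¹' E) ≤ μ.real Bad := measureReal_mono hinter
  linarith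

/-- The lower bound in dimension `n` of order `1 / ε`, by averaging over both the coins and the
Gaussian inputs. -/
lemma EstimatesTrace.lt_two_mul_queries {alg : NonadaptiveAlgorithm Ω n m} {P : Measure Ω}
    [IsProbabilityMeasure P] {ε : ℝ} (halg : alg.EstimatesTrace P ε) (hε0 : 0 < ε)
    (hε2 : ε ≤ 1 / 2) (hn : 1 ≤ n) (hεn : 480 * ε * n < 1) : n < 2 * m := by
  by_contra! hmn
  set μ := gaussianPi (EuclideanSpace ℝ (Fin n × Fin n)) with hμ
  have hS := alg.measurableSet_successSet ε
  have hupper : (P.prod μ) (alg.successSet ε) ≤ ENNReal.ofReal (27 / 40) := by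
    rw [Measure.prod_apply hS]
    calc ∫⁻ ω, μ (Prod.mk ω ⁻¹' alg.successSet ε) ∂P
        ≤ ∫⁻ _, ENNReal.ofReal (27 / 40) ∂P := by
          refine lintegral_mono fun ω => ?_
          rw [← ofReal_measureReal (μ := μ)]
          exact ENNReal.ofReal_le_ofReal
            (alg.gaussianPi_successSet_le hε2 hn hmn hεn hε0 ω)
      _ = ENNReal.ofReal (27 / 40) := by simp
  set Bad := {G : EuclideanSpace ℝ (Fin n × Fin n) |
    ∃ x, 3 * √n * ‖x‖ ^ 2 < |inner ℝ (selfTensor x) G|} with hBad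
  have hbad : μ.real Bad ≤ 1 / 20 := gaussianPi_exists_lt_abs_inner_selfTensor_le hn
  have hgood : 19 / 20 ≤ μ.real Badᶜ := by
    have h1 := measureReal_union_le (μ := μ) Bad Badᶜ
    rw [Set.union_compl_self, probReal_univ] at h1
    linarith
  have hlower : ENNReal.ofReal (3 / 4) * μ Badᶜ ≤ (P.prod μ) (alg.successSet ε) := by
    rw [Measure.prod_apply_symm hS]
    refine le_trans ?_ (mul_meas_ge_le_lintegral (measurable_measure_prodMk_right hS)
      (ENNReal.ofReal (3 / 4)))
    gcongr
    intro G hG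
    have hG' : ∀ x, |inner ℝ (selfTensor x) G| ≤ 3 * √n * ‖x‖ ^ 2 := by
      simpa [hBad] using hG
    have h2 := halg _ (posSemidef_shiftedSymm hG')
    change ENNReal.ofReal (3 / 4) ≤ P ((fun ω => (ω, G)) ⁻¹' alg.successSet ε)
    rw [← ofReal_measureReal (μ := P)]
    exact ENNReal.ofReal_le_ofReal h2.le
  have hreal := ENNReal.toReal_mono ENNReal.ofReal_ne_top (hlower.trans hupper)
  rw [ENNReal.toReal_mul, ENNReal.toReal_ofReal (by norm_num), ENNReal.toReal_ofReal (by norm_num),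
    ← measureReal_def] at hreal
  linarith

end NonadaptiveAlgorithm

theorem theorem7 :
    ∃ c C : ℝ, 0 < c ∧ 0 < C ∧
      ∀ ε : ℝ, 0 < ε → ε < 1 →
      ∀ d : ℕ, C / ε ≤ (d : ℝ) →
      ∀ (m : ℕ) (Ω : Type*) [MeasurableSpace Ω] (P : Measure Ω) [IsProbabilityMeasure P]
        (alg : NonadaptiveAlgorithm Ω d m),
        alg.EstimatesTrace P ε → c / ε ≤ (m : ℝ) := by
  refine ⟨1 / 2000, 1, by norm_num, one_pos, ?_⟩
  intro ε hε0 hε1 d hd m Ω _ P _ alg halg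
  have hd0 : 0 < d := by
    have : (0 : ℝ) < d := (by positivity : (0 : ℝ) < 1 / ε).trans_le hd
    exact_mod_cast this
  have hm : (1 : ℝ) ≤ m := by exact_mod_cast halg.queries_pos hε1 hd0
  rw [div_le_iff₀ hε0] at hd ⊢
  rcases le_or_gt (1 / 500) ε with hε | hε
  · nlinarith
  -- a dimension of order `1 / ε` is the hardest: the bound for `n × n` inputs is about `n / 2`
  set n := ⌊1 / (500 * ε)⌋₊ with hn
  have hx : (1 : ℝ) ≤ 1 / (500 * ε) := by
    rw [le_div_iff₀ (by positivity)]; linarith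
  have hn1 : 1 ≤ n := Nat.le_floor (by exact_mod_cast hx)
  have hnle : (n : ℝ) * (500 * ε) ≤ 1 := by
    rw [← le_div_iff₀ (by positivity)]
    exact Nat.floor_le (by positivity)
  have hnlt : 1 < ((n : ℝ) + 1) * (500 * ε) := by
    rw [← div_lt_iff₀ (by positivity)]
    exact Nat.lt_floor_add_one _
  have hn1' : (1 : ℝ) ≤ n := by exact_mod_cast hn1
  have hnd : n ≤ d := by
    have : (n : ℝ) ≤ d := by
      by_contra! hlt
      nlinarith
    exact_mod_cast this
  have hlt := (halg.restrict hnd).lt_two_mul_queries hε0 (by linarith) hn1 (by nlinarith)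
  have hlt' : (n : ℝ) < 2 * m := by exact_mod_cast hlt
  nlinarith
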